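/- Let $\mathcal V$ be a finite set of agents, $\mathcal V_s\subseteq\mathcal V$ a (possibly empty) set of stubborn agents, $d$ a natural number, and $\mathcal O\subseteq\mathbb R^d$ a confidence set. A state is a family $\Xi=(\xi^i)_{i\in\mathcal V}$ of opinions $\xi^i\in\mathbb R^d$. Put $\mathcal N_i(\Xi)=\{j\in\mathcal V:\xi^j-\xi^i\in\mathcal O\}$ for $i\in\mathcal V\setminus\mathcal V_s$ and $\mathcal N_i(\Xi)=\{i\}$ for $i\in\mathcal V_s$. The SCOD dynamics (set-based Hegselmann–Krause dynamics) are $$\xi^i(t+1)=\frac1{|\mathcal N_i(\Xi(t))|}\sum_{j\in\mathcal N_i(\Xi(t))}\xi^j(t),\qquad i\in\mathcal V,\ t=0,1,2,\dots$$ An equilibrium is a state that is left unchanged by this update. A state $\Xi$ is clustered if for all $i,j\in\mathcal V$ either $\xi^i=\xi^j$ or $\xi^j-\xi^i\notin\mathcal O$. Assume that $0\in\mathcal O$ and $\mathcal O=-\mathcal O$, and let $\Xi(t)$ be a trajectory of the dynamics such that, for some $\xi^*\in\mathbb R^d$, $\xi^i(0)=\xi^*$ for all $i\in\mathcal V_s$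 (no condition if $\mathcal V_s=\emptyset$). Then: (A) $\Xi(0)$ is an equilibrium if and only if it is clustered. (B) Every opinion has a finite limit $\xi^i(\infty)=\lim_{t\to\infty}\xi^i(t)\in\mathbb R^d$, and $\xi^i(\infty)=\xi^j(\infty)$ whenever $i$ and $j$ trust each other infinitely often, that is, $\xi^j(t)-\xi^i(t)\in\mathcal O$ for infinitely many $t$. If, moreover, $\mathcal O\supseteq\{\xi:\|\xi\|<R\}$ for some $R>0$, then: (C) The limit state $\Xi(\infty)=(\xi^i(\infty))_{i\in\mathcal V}$ is an equilibrium and is clustered. (D) If $\mathcal V_s=\emptyset$, the dynamics terminate in finitely many steps: there is $T$ with $\Xi(t)=\Xi(T)$ for all $t\ge T$. If $\mathcal V_s\ne\emptyset$, then for each $i\in\mathcal V$ either $\xi^i(t)\to\xi^*$ as $t\to\infty$, or there is $T$ with $\xi^i(t)=\xi^i(T)$ for all $t\ge T$. -/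

import Mathlib

open Filter Topology

noncomputable section

namespace SCOD

/-- A system state: the opinion vector in `ℝ^d` of each agent (the rows of the opinion matrix). -/
abbrev State (V : Type*) (d : ℕ) := V → EuclideanSpace ℝ (Fin d)

/-- In the state `X`, the opinion of agent `j` is admissible for agent `i`:
`X j - X i` belongs to the confidence set `O`. -/
def Trusts {V : Type*} {d : ℕ} (O : Set (EuclideanSpace ℝ (Fin d)))
    (X : State V d) (i j : V) : Prop :=
  X j - X i ∈ O

open Classical in
/-- The set of neighbors of agent `i` in the state `X`, where `S` is the set of stubborn agents:
a stubborn agent has itself as its only neighbor, a regular agent has all agents it trusts. -/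
def neighbors {V : Type*} [Fintype V] {d : ℕ} (O : Set (EuclideanSpace ℝ (Fin d))) (S : Set V)
    (X : State V d) (i : V) : Finset V :=
  if i ∈ S then {i} else Finset.univ.filter (fun j => Trusts O X i j)

/-- One opinion update: every agent takes the average of the opinions of its neighbors. -/
def step {V : Type*} [Fintype V] {d : ℕ} (O : Set (EuclideanSpace ℝ (Fin d))) (S : Set V)
    (X : State V d) : State V d :=
  fun i => ((neighbors O S X i).card : ℝ)⁻¹ • ∑ j ∈ neighbors O S X i, X j

/-- `ξ` is a trajectory of the dynamics; `ξ t i` is the opinion of agent `i` at time `t`. -/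
def IsSolution {V : Type*} [Fintype V] {d : ℕ} (O : Set (EuclideanSpace ℝ (Fin d))) (S : Set V)
    (ξ : ℕ → State V d) : Prop :=
  ∀ t, ξ (t + 1) = step O S (ξ t)

/-- An equilibrium is a state that the update leaves unchanged. -/
def IsEquilibrium {V : Type*} [Fintype V] {d : ℕ} (O : Set (EuclideanSpace ℝ (Fin d)))
    (S : Set V) (X : State V d) : Prop :=
  step O S X = X

/-- A state is clustered if any two agents hold equal opinions or the first does not find the
opinion of the second admissible. -/
def IsClustered {V : Type*} {d : ℕ} (O : Set (EuclideanSpace ℝ (Fin d)))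
    (X : State V d) : Prop :=
  ∀ i j, X i = X j ∨ X j - X i ∉ O

end SCOD

end

namespace SCOD

/-! ### Consensus for scalar averaging on a time-varying graph. -/

section Averaging

variable {V : Type*}

/-! Each coordinate of the opinions is averaged over time-varying neighborhoods. Group the agents
into classes by chains of infinitely recurring trust: after some time no trust crosses classes. On a
class the maximum decreases to some `L`. If one agent, together with the stubborn agents of its
class, lies `δ` below the maximum, this deficit spreads over the class, shrinking at most by the
factor `card V` per agent reached, however long the waits (`exists_le`). Hence `L ≤ max - δ / c`, so
`δ ≤ c * (max - L)` tends to `0`. By negation that agent also tracks the minimum, and the class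
reaches consensus.

If `O` is a neighborhood of `0`, trust eventually amounts to equality of limits. Agents sharing a
limit that no stubborn agent has then see the same neighbors, merge in one step and freeze. So every
limit value is eventually held exactly by some agent, which makes the limit state clustered. -/

/-- The mean of a family bounded by `M`, one of whose members is at most `M - δ`. -/
theorem mean_le_sub_div {s : Finset V} {f : V → ℝ} {M δ n : ℝ} {j : V} (hj : j ∈ s)
    (hn : (s.card : ℝ) ≤ n) (hδ : 0 ≤ δ) (hf : ∀ i ∈ s, f i ≤ M) (hfj : f j ≤ M - δ) :
    (s.card : ℝ)⁻¹ * ∑ i ∈ s, f i ≤ M - δ / n := by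
  have hs : (0 : ℝ) < s.card := by exact_mod_cast Finset.card_pos.2 ⟨j, hj⟩
  have hsum : δ ≤ ∑ i ∈ s, (M - f i) :=
    (by linarith : δ ≤ M - f j).trans
      (Finset.single_le_sum (f := fun i => M - f i) (fun i hi => sub_nonneg.2 (hf i hi)) hj)
  rw [Finset.sum_sub_distrib, Finset.sum_const, nsmul_eq_mul] at hsum
  have hdiv : δ / n ≤ δ / s.card := div_le_div_of_nonneg_left hδ hs hn
  have : (s.card : ℝ)⁻¹ * ∑ i ∈ s, f i ≤ M - δ / s.card := by
    rw [inv_mul_le_iff₀ hs, mul_sub, mul_div_cancel₀ _ hs.ne']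
    linarith
  linarith

theorem mean_le {s : Finset V} {f : V → ℝ} {M : ℝ} (hs : s.Nonempty)
    (hf : ∀ i ∈ s, f i ≤ M) : (s.card : ℝ)⁻¹ * ∑ i ∈ s, f i ≤ M := by
  obtain ⟨j, hj⟩ := hs
  simpa using mean_le_sub_div hj le_rfl le_rfl hf (by simpa using hf j hj)

/-- A time-varying graph on the vertex set `C` with neighborhoods `N t i`, which is symmetric
except that the vertices in `B` have no neighbors but themselves, and in which every proper
subset of `C` containing `B ∩ C` is linked to its complement infinitely often. -/
structure IsRepeatedlyConnected (N : ℕ → V → Finset V) (C : Finset V) (B : Set V) : Prop where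
  self_mem : ∀ t i, i ∈ N t i
  subset : ∀ t, ∀ i ∈ C, N t i ⊆ C
  eq_singleton : ∀ t, ∀ i ∈ B, N t i = {i}
  symm : ∀ t i j, i ∉ B → j ∉ B → j ∈ N t i → i ∈ N t j
  exists_link : ∀ A ⊆ C, A.Nonempty → (∀ i ∈ C, i ∈ B → i ∈ A) → A ≠ C →
    ∀ t, ∃ s ≥ t, ∃ a ∈ A, ∃ b ∈ C, b ∉ A ∧ a ∈ N s b

/-- The function `u` is updated by averaging over the neighborhoods `N t i`. -/
def IsAveraging (N : ℕ → V → Finset V) (u : ℕ → V → ℝ) : Prop :=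
  ∀ t i, u (t + 1) i = ((N t i).card : ℝ)⁻¹ * ∑ j ∈ N t i, u t j

theorem IsAveraging.neg {N : ℕ → V → Finset V} {u : ℕ → V → ℝ} (hu : IsAveraging N u) :
    IsAveraging N (fun t i => -u t i) := by
  intro t i
  simp [hu t i]

variable {N : ℕ → V → Finset V} {C : Finset V} {B : Set V} {u : ℕ → V → ℝ}

/-- An upper bound on a set of vertices without outgoing links persists. -/
theorem IsAveraging.le_succ (hu : IsAveraging N u) (hN : ∀ t i, i ∈ N t i) {A : Finset V} {t : ℕ}
    {M : ℝ} (hA : ∀ i ∈ A, N t i ⊆ A) (hM : ∀ i ∈ A, u t i ≤ M) : ∀ i ∈ A, u (t + 1) i ≤ M := by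
  intro i hi
  rw [hu]
  exact mean_le ⟨i, hN t i⟩ fun j hj => hM j (hA i hi hj)

/-- If there are no links from `C \ A` to `A`, then there are none from `A` to `C \ A`. -/
theorem IsRepeatedlyConnected.subset_of_not_link (h : IsRepeatedlyConnected N C B)
    {A : Finset V} (hAC : A ⊆ C) (hBA : ∀ i ∈ C, i ∈ B → i ∈ A) {t : ℕ}
    (ht : ¬ ∃ a ∈ A, ∃ b ∈ C, b ∉ A ∧ a ∈ N t b) : ∀ i ∈ A, N t i ⊆ A := by
  intro i hi j hj
  by_contra hjA
  have hjC : j ∈ C := h.subset t i (hAC hi) hj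
  by_cases hiB : i ∈ B
  · rw [h.eq_singleton t i hiB, Finset.mem_singleton] at hj
    exact hjA (hj ▸ hi)
  · exact ht ⟨i, hi, j, hjC, hjA, h.symm t i j hiB (fun hjB => hjA (hBA j hjC hjB)) hj⟩

theorem IsRepeatedlyConnected.antitone_sup (h : IsRepeatedlyConnected N C B)
    (hu : IsAveraging N u) (hC : C.Nonempty) : Antitone fun t => C.sup' hC (u t) :=
  antitone_nat_of_succ_le fun t => Finset.sup'_le _ _
    (hu.le_succ h.self_mem (h.subset t) fun _ hi => Finset.le_sup' (u t) hi)

variable [Fintype V]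

/-- A strict upper bound on a part of `C` that contains `B ∩ C` spreads over `C`. -/
theorem IsRepeatedlyConnected.exists_le (h : IsRepeatedlyConnected N C B) (hu : IsAveraging N u)
    {M : ℝ} (k : ℕ) : ∀ (A : Finset V) (δ : ℝ) (t : ℕ), A ⊆ C → A.Nonempty →
      (∀ i ∈ C, i ∈ B → i ∈ A) → C.card ≤ A.card + k → 0 ≤ δ →
      (∀ i ∈ C, u t i ≤ M) → (∀ i ∈ A, u t i ≤ M - δ) →
      ∃ s ≥ t, ∀ i ∈ C, u s i ≤ M - δ / (Fintype.card V : ℝ) ^ k := by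
  classical
  induction k with
  | zero =>
    intro A δ t hAC _ _ hcard _ _ hA
    obtain rfl := Finset.eq_of_subset_of_card_le hAC (by simpa using hcard)
    exact ⟨t, le_rfl, by simpa using hA⟩
  | succ k ih =>
    intro A δ t hAC hne hBA hcard hδ hM hA
    have hn : (1 : ℝ) ≤ Fintype.card V := by
      exact_mod_cast Fintype.card_pos_iff.2 ⟨hne.choose⟩
    by_cases hEq : A = C
    · subst hEq
      refine ⟨t, le_rfl, fun i hi => (hA i hi).trans ?_⟩
      have := div_le_self hδ (one_le_pow₀ hn (n := k + 1))
      linarith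
    have hex : ∃ m, ∃ a ∈ A, ∃ b ∈ C, b ∉ A ∧ a ∈ N (t + m) b := by
      obtain ⟨s, hs, hlink⟩ := h.exists_link A hAC hne hBA hEq t
      exact ⟨s - t, by rwa [Nat.add_sub_cancel' hs]⟩
    have hkeep : ∀ m ≤ Nat.find hex,
        (∀ i ∈ C, u (t + m) i ≤ M) ∧ ∀ i ∈ A, u (t + m) i ≤ M - δ := by
      intro m
      induction m with
      | zero => exact fun _ => ⟨hM, hA⟩
      | succ m ihm =>
        intro hm
        obtain ⟨h1, h2⟩ := ihm (by omega)
        exact ⟨hu.le_succ h.self_mem (h.subset _) h1, hu.le_succ h.self_mem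
          (h.subset_of_not_link hAC hBA (Nat.find_min hex (by omega))) h2⟩
    obtain ⟨h1, h2⟩ := hkeep _ le_rfl
    obtain ⟨a, ha, b, hbC, hbA, hab⟩ := Nat.find_spec hex
    generalize t + Nat.find hex = s, Nat.le_add_right t (Nat.find hex) = hts at *
    have hcardN : ∀ i, ((N s i).card : ℝ) ≤ Fintype.card V := fun i => by
      exact_mod_cast Finset.card_le_univ _
    -- At the link `b` averages in `a`, and each member of `A` averages in itself.
    have hA' : ∀ i ∈ insert b A, u (s + 1) i ≤ M - δ / Fintype.card V := by
      intro i hi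
      rw [hu]
      rcases Finset.mem_insert.1 hi with rfl | hi
      · exact mean_le_sub_div hab (hcardN _) hδ (fun j hj => h1 j (h.subset s _ hbC hj)) (h2 a ha)
      · exact mean_le_sub_div (h.self_mem s i) (hcardN i) hδ
          (fun j hj => h1 j (h.subset s i (hAC hi) hj)) (h2 i hi)
    obtain ⟨s', hs', hle⟩ := ih (insert b A) (δ / Fintype.card V) (s + 1)
      (Finset.insert_subset hbC hAC) (Finset.insert_nonempty _ _)
      (fun i hi hiB => Finset.mem_insert_of_mem (hBA i hi hiB))
      (by rw [Finset.card_insert_of_notMem hbA]; omega) (by positivity)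
      (hu.le_succ h.self_mem (h.subset s) h1) hA'
    refine ⟨s', by omega, fun i hi => (hle i hi).trans_eq ?_⟩
    rw [div_div, pow_succ']

/-- The maximum of `u` over `C` tends to the same limit as the value at a vertex that agrees with
all vertices in `B ∩ C`. -/
theorem IsRepeatedlyConnected.exists_tendsto_sup (h : IsRepeatedlyConnected N C B)
    (hu : IsAveraging N u) {i₀ : V} (hi₀ : i₀ ∈ C) (hB : ∀ t, ∀ i ∈ C, i ∈ B → u t i = u t i₀) :
    ∃ L, Tendsto (fun t => C.sup' ⟨i₀, hi₀⟩ (u t)) atTop (𝓝 L) ∧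
      Tendsto (fun t => u t i₀) atTop (𝓝 L) := by
  classical
  have hC : C.Nonempty := ⟨i₀, hi₀⟩
  have hanti := h.antitone_sup hu hC
  have hanti' := h.antitone_sup hu.neg hC
  have hbdd : BddBelow (Set.range fun t => C.sup' hC (u t)) := by
    refine ⟨-C.sup' hC (fun i => -u 0 i), ?_⟩
    rintro _ ⟨t, rfl⟩
    have h1 := Finset.le_sup' (u t) hi₀
    have h2 := Finset.le_sup' (fun i => -u t i) hi₀
    have h3 := hanti' (Nat.zero_le t)
    dsimp only at h1 h2 h3 ⊢
    linarith
  have hlim := tendsto_atTop_ciInf hanti hbdd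
  set L := ⨅ t, C.sup' hC (u t)
  refine ⟨L, hlim, ?_⟩
  set c : ℝ := (Fintype.card V : ℝ) ^ C.card
  have hc : 0 < c := by
    have : 0 < Fintype.card V := Fintype.card_pos_iff.2 ⟨i₀⟩
    positivity
  -- No later maximum falls below `L`, so the spread deficit of `i₀` is at most the gap to `L`.
  have hlow : ∀ t, C.sup' hC (u t) - c * (C.sup' hC (u t) - L) ≤ u t i₀ := by
    intro t
    obtain ⟨s, -, hs⟩ := h.exists_le hu (M := C.sup' hC (u t)) C.card
      (insert i₀ (C.filter (· ∈ B))) (C.sup' hC (u t) - u t i₀) t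
      (Finset.insert_subset hi₀ (Finset.filter_subset _ _)) (Finset.insert_nonempty _ _)
      (fun i hi hiB => Finset.mem_insert_of_mem (Finset.mem_filter.2 ⟨hi, hiB⟩))
      (Nat.le_add_left _ _) (sub_nonneg.2 (Finset.le_sup' (u t) hi₀))
      (fun i hi => Finset.le_sup' (u t) hi) (by
        intro i hi
        rcases Finset.mem_insert.1 hi with rfl | hi
        · simp
        · rw [hB t i (Finset.mem_filter.1 hi).1 (Finset.mem_filter.1 hi).2]
          simp)
    have hL : L ≤ C.sup' hC (u t) - (C.sup' hC (u t) - u t i₀) / c :=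
      (ciInf_le hbdd s).trans (Finset.sup'_le _ _ hs)
    have := mul_le_mul_of_nonneg_left hL hc.le
    rw [mul_sub, mul_div_cancel₀ _ hc.ne'] at this
    linarith
  refine tendsto_of_tendsto_of_tendsto_of_le_of_le ?_ hlim hlow
    fun t => Finset.le_sup' (u t) hi₀
  simpa using hlim.sub ((hlim.sub_const L).const_mul c)

/-- The value at `i₀` shares its limit with both the maximum and, through `-u`, the minimum; these
squeeze all of `C`. -/
theorem IsRepeatedlyConnected.exists_tendsto (h : IsRepeatedlyConnected N C B)
    (hu : IsAveraging N u) {i₀ : V} (hi₀ : i₀ ∈ C) (hB : ∀ t, ∀ i ∈ C, i ∈ B → u t i = u t i₀) :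
    ∃ L, ∀ i ∈ C, Tendsto (fun t => u t i) atTop (𝓝 L) := by
  obtain ⟨L, hsup, hL⟩ := h.exists_tendsto_sup hu hi₀ hB
  obtain ⟨L', hsup', hL'⟩ := h.exists_tendsto_sup hu.neg hi₀
    (fun t i hi hiB => by rw [hB t i hi hiB])
  obtain rfl : L = -L' := tendsto_nhds_unique hL (by simpa using hL'.neg)
  refine ⟨-L', fun i hi => tendsto_of_tendsto_of_tendsto_of_le_of_le hsup'.neg hsup
    (fun t => ?_) fun t => Finset.le_sup' (u t) hi⟩
  exact neg_le.1 (Finset.le_sup' (fun i => -u t i) hi)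

end Averaging

/-! ### Trust classes and convergence of opinions. -/

section Dynamics

variable {V : Type*} {d : ℕ} {O : Set (EuclideanSpace ℝ (Fin d))} {S : Set V}

theorem trusts_comm (hsymm : ∀ x, x ∈ O ↔ -x ∈ O) {X : State V d} {i j : V} :
    Trusts O X i j ↔ Trusts O X j i := by
  rw [Trusts, Trusts, hsymm, neg_sub]

theorem trusts_of_eq (hzero : 0 ∈ O) {X : State V d} {i j : V} (hij : X i = X j) :
    Trusts O X i j := by
  simpa [Trusts, hij] using hzero

/-- Agents linked by a chain of mutual trust, each link of which recurs infinitely often. -/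
def RecurrentlyLinked (O : Set (EuclideanSpace ℝ (Fin d))) (ξ : ℕ → State V d) : V → V → Prop :=
  Relation.ReflTransGen fun i j => ∃ᶠ t in atTop, Trusts O (ξ t) i j

theorem RecurrentlyLinked.symm (hsymm : ∀ x, x ∈ O ↔ -x ∈ O) {ξ : ℕ → State V d} {i j : V}
    (h : RecurrentlyLinked O ξ i j) : RecurrentlyLinked O ξ j i :=
  haveI : Std.Symm fun i j => ∃ᶠ t in atTop, Trusts O (ξ t) i j :=
    ⟨fun _ _ h => h.mono fun _ => (trusts_comm hsymm).1⟩
  Relation.ReflTransGen.stdSymm.symm _ _ h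

variable [Fintype V]

theorem neighbors_of_mem {X : State V d} {i : V} (hi : i ∈ S) : neighbors O S X i = {i} := by
  simp [neighbors, hi]

theorem mem_neighbors_of_notMem {X : State V d} {i j : V} (hi : i ∉ S) :
    j ∈ neighbors O S X i ↔ Trusts O X i j := by
  simp [neighbors, hi]

theorem self_mem_neighbors (hzero : 0 ∈ O) (X : State V d) (i : V) : i ∈ neighbors O S X i := by
  by_cases hi : i ∈ S
  · simp [neighbors_of_mem hi]
  · exact (mem_neighbors_of_notMem hi).2 (trusts_of_eq hzero rfl)

theorem trusts_of_mem_neighbors (hzero : 0 ∈ O) {X : State V d} {i j : V}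
    (hj : j ∈ neighbors O S X i) : Trusts O X i j := by
  by_cases hi : i ∈ S
  · rw [neighbors_of_mem hi, Finset.mem_singleton] at hj
    exact trusts_of_eq hzero (by rw [hj])
  · exact (mem_neighbors_of_notMem hi).1 hj

theorem step_of_mem {X : State V d} {i : V} (hi : i ∈ S) : step O S X i = X i := by
  simp [step, neighbors_of_mem hi]

/-- An agent keeps its opinion if all its neighbors share it. -/
theorem step_eq_self (hzero : 0 ∈ O) {X : State V d} {i : V}
    (h : ∀ j ∈ neighbors O S X i, X j = X i) : step O S X i = X i := by
  have hcard : ((neighbors O S X i).card : ℝ) ≠ 0 := by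
    exact_mod_cast (Finset.card_pos.2 ⟨i, self_mem_neighbors hzero X i⟩).ne'
  rw [step, Finset.sum_congr rfl h, Finset.sum_const, ← Nat.cast_smul_eq_nsmul ℝ, smul_smul,
    inv_mul_cancel₀ hcard, one_smul]

theorem IsClustered.isEquilibrium (hzero : 0 ∈ O) {X : State V d} (hX : IsClustered O X) :
    IsEquilibrium O S X :=
  funext fun i => step_eq_self hzero fun j hj =>
    ((hX i j).resolve_right (not_not_intro (trusts_of_mem_neighbors hzero hj))).symm

theorem IsSolution.eq_of_mem {ξ : ℕ → State V d} (hξ : IsSolution O S ξ) {i : V} (hi : i ∈ S)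
    (t : ℕ) : ξ t i = ξ 0 i := by
  induction t with
  | zero => rfl
  | succ t ih => rw [hξ t, step_of_mem hi, ih]

theorem IsSolution.isAveraging {ξ : ℕ → State V d} (hξ : IsSolution O S ξ) (k : Fin d) :
    IsAveraging (fun t => neighbors O S (ξ t)) (fun t i => ξ t i k) := by
  intro t i
  have := congrArg (EuclideanSpace.proj k : EuclideanSpace ℝ (Fin d) →L[ℝ] ℝ)
    (congrFun (hξ t) i)
  simpa [step, map_sum] using this

-- There are finitely many pairs, so beyond a common `T` only recurrent pairs trust each other and
-- classes are closed.
open Classical in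
theorem exists_isRepeatedlyConnected (hzero : 0 ∈ O) (hsymm : ∀ x, x ∈ O ↔ -x ∈ O)
    (ξ : ℕ → State V d) : ∃ T, ∀ i, IsRepeatedlyConnected
      (fun t => neighbors O S (ξ (t + T))) (Finset.univ.filter (RecurrentlyLinked O ξ i)) S := by
  have hev : ∀ᶠ t in atTop, ∀ i j, Trusts O (ξ t) i j → ∃ᶠ t in atTop, Trusts O (ξ t) i j := by
    refine eventually_all.2 fun i => eventually_all.2 fun j => ?_
    by_cases h : ∃ᶠ t in atTop, Trusts O (ξ t) i j
    · exact Eventually.of_forall fun _ _ => h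
    · exact (not_frequently.1 h).mono fun _ ht ht' => absurd ht' ht
  obtain ⟨T, hT⟩ := eventually_atTop.1 hev
  refine ⟨T, fun i => ⟨fun t j => self_mem_neighbors hzero _ j, fun t j hj k hk => ?_,
    fun t j hj => neighbors_of_mem hj, fun t j k hj hk hjk => ?_, fun A hAC hne hSA hAne t => ?_⟩⟩
  · simp only [Finset.mem_filter, Finset.mem_univ, true_and] at hj ⊢
    exact hj.tail (hT _ (Nat.le_add_left _ _) _ _ (trusts_of_mem_neighbors hzero hk))
  · rw [mem_neighbors_of_notMem hj] at hjk
    rw [mem_neighbors_of_notMem hk]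
    exact (trusts_comm hsymm).1 hjk
  · obtain ⟨a, ha, b, hb, hab⟩ : ∃ a ∈ A, ∃ b, b ∉ A ∧ ∃ᶠ t in atTop, Trusts O (ξ t) a b := by
      -- If no recurrent pair left `A`, chains from `a` would make `A` the whole class.
      by_contra! hcl
      obtain ⟨a, ha⟩ := hne
      refine hAne (hAC.antisymm fun c hc => ?_)
      have hac : RecurrentlyLinked O ξ a c :=
        (RecurrentlyLinked.symm hsymm (Finset.mem_filter.1 (hAC ha)).2).trans
          (Finset.mem_filter.1 hc).2
      clear hc
      induction hac with
      | refl => exact ha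
      | tail _ hxy ih =>
        by_contra hy
        exact hxy (hcl _ ih _ hy)
    have hbC : b ∈ Finset.univ.filter (RecurrentlyLinked O ξ i) := by
      have := (Finset.mem_filter.1 (hAC ha)).2
      exact Finset.mem_filter.2 ⟨Finset.mem_univ _, this.tail hab⟩
    obtain ⟨s, hs, hs'⟩ := frequently_atTop.1 hab (t + T)
    refine ⟨s - T, by omega, a, ha, b, hbC, hb, ?_⟩
    -- `A` contains the stubborn agents of the class, so `b` is regular and averages over `a`.
    rw [mem_neighbors_of_notMem fun hbS => hb (hSA b hbC hbS), Nat.sub_add_cancel (by omega)]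
    exact (trusts_comm hsymm).1 hs'

/-- Every opinion converges, and agents that trust each other infinitely often have the same
limit. -/
theorem IsSolution.exists_tendsto (hzero : 0 ∈ O) (hsymm : ∀ x, x ∈ O ↔ -x ∈ O)
    {ξ : ℕ → State V d} (hξ : IsSolution O S ξ) {ξstar : EuclideanSpace ℝ (Fin d)}
    (hstub : ∀ i ∈ S, ξ 0 i = ξstar) :
    ∃ ξlim : State V d, (∀ i, Tendsto (fun t => ξ t i) atTop (𝓝 (ξlim i))) ∧
      ∀ i j, (∃ᶠ t in atTop, Trusts O (ξ t) i j) → ξlim i = ξlim j := by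
  classical
  obtain ⟨T, hT⟩ := exists_isRepeatedlyConnected (S := S) hzero hsymm ξ
  have hcoord : ∀ i k, ∃ L, ∀ j, RecurrentlyLinked O ξ i j →
      Tendsto (fun t => ξ t j k) atTop (𝓝 L) := by
    intro i k
    -- The reference agent is stubborn if the class has such an agent; all stubborn agents stay at
    -- `ξstar`.
    obtain ⟨i₀, hi₀, hS⟩ : ∃ i₀, RecurrentlyLinked O ξ i i₀ ∧
        ∀ j, RecurrentlyLinked O ξ i j → j ∈ S → ∀ t, ξ t j = ξ t i₀ := by
      by_cases hex : ∃ i₀, RecurrentlyLinked O ξ i i₀ ∧ i₀ ∈ S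
      · obtain ⟨i₀, hi₀, hi₀S⟩ := hex
        refine ⟨i₀, hi₀, fun j _ hj t => ?_⟩
        rw [hξ.eq_of_mem hj, hξ.eq_of_mem hi₀S, hstub j hj, hstub i₀ hi₀S]
      · exact ⟨i, .refl, fun j hj hjS => absurd ⟨j, hj, hjS⟩ hex⟩
    have hu : IsAveraging (fun t => neighbors O S (ξ (t + T))) (fun t j => ξ (t + T) j k) :=
      fun t j => by simpa [Nat.add_right_comm] using hξ.isAveraging k (t + T) j
    obtain ⟨L, hL⟩ := (hT i).exists_tendsto hu (i₀ := i₀) (by simpa using hi₀)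
      (fun t j hj hjS => by rw [hS j (by simpa using hj) hjS])
    exact ⟨L, fun j hj => (tendsto_add_atTop_iff_nat (f := fun t => ξ t j k) T).1
      (hL j (by simpa using hj))⟩
  have hvec : ∀ i, ∃ L : EuclideanSpace ℝ (Fin d), ∀ j, RecurrentlyLinked O ξ i j →
      Tendsto (fun t => ξ t j) atTop (𝓝 L) := by
    intro i
    choose L hL using hcoord i
    refine ⟨WithLp.toLp 2 L, fun j hj => ?_⟩
    exact ((PiLp.continuous_toLp 2 _).tendsto L).comp (tendsto_pi_nhds.2 fun k => hL k j hj)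
  choose ξlim hlim using hvec
  exact ⟨ξlim, fun i => hlim i i .refl, fun i j hij =>
    tendsto_nhds_unique (hlim i j (.single hij)) (hlim j j .refl)⟩

/-- On a constant trajectory trust holding once recurs forever, and the limits are the opinions
themselves. -/
theorem IsEquilibrium.isClustered (hzero : 0 ∈ O) (hsymm : ∀ x, x ∈ O ↔ -x ∈ O)
    {X : State V d} (hX : IsEquilibrium O S X) {ξstar : EuclideanSpace ℝ (Fin d)}
    (hstub : ∀ i ∈ S, X i = ξstar) : IsClustered O X := by
  obtain ⟨ξlim, hlim, heq⟩ :=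
    IsSolution.exists_tendsto (ξ := fun _ => X) hzero hsymm (fun _ => hX.symm) hstub
  have hconst : ∀ i, X i = ξlim i := fun i => tendsto_nhds_unique tendsto_const_nhds (hlim i)
  intro i j
  by_cases hij : X j - X i ∈ O
  · left
    rw [hconst i, hconst j]
    exact heq i j (Frequently.of_forall fun _ => hij)
  · exact Or.inr hij

/-! ### Finite-time behavior when `O` is a neighborhood of `0`. -/

/-- If `O` is a neighborhood of `0`, then trust eventually means having the same limit. -/
theorem eventually_trusts_iff {ξ : ℕ → State V d} {ξlim : State V d}
    (hlim : ∀ i, Tendsto (fun t => ξ t i) atTop (𝓝 (ξlim i)))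
    (heq : ∀ i j, (∃ᶠ t in atTop, Trusts O (ξ t) i j) → ξlim i = ξlim j) (hO : O ∈ 𝓝 0) :
    ∀ᶠ t in atTop, ∀ i j, Trusts O (ξ t) i j ↔ ξlim i = ξlim j := by
  refine eventually_all.2 fun i => eventually_all.2 fun j => ?_
  by_cases hij : ξlim i = ξlim j
  · have hsub : Tendsto (fun t => ξ t j - ξ t i) atTop (𝓝 0) := by
      simpa [hij] using (hlim j).sub (hlim i)
    exact (hsub.eventually_mem hO).mono fun t ht => iff_of_true ht hij
  · exact (not_frequently.1 (mt (heq i j) hij)).mono fun t ht => iff_of_false ht hij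

/-- If `O` is a neighborhood of `0`, then an agent whose limit differs from the opinions of the
stubborn agents reaches it in finite time. -/
theorem IsSolution.eventually_eq_lim (hzero : 0 ∈ O) {ξ : ℕ → State V d} (hξ : IsSolution O S ξ)
    {ξlim : State V d} (hlim : ∀ i, Tendsto (fun t => ξ t i) atTop (𝓝 (ξlim i)))
    (heq : ∀ i j, (∃ᶠ t in atTop, Trusts O (ξ t) i j) → ξlim i = ξlim j) (hO : O ∈ 𝓝 0)
    {i : V} (hi : ∀ j ∈ S, ξlim j ≠ ξlim i) : ∀ᶠ t in atTop, ξ t i = ξlim i := by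
  obtain ⟨T, hT⟩ := eventually_atTop.1 (eventually_trusts_iff hlim heq hO)
  have hreg : ∀ j, ξlim j = ξlim i → j ∉ S := fun j hj hjS => hi j hjS hj
  have hnb : ∀ t ≥ T, ∀ j, ξlim j = ξlim i → ∀ k,
      k ∈ neighbors O S (ξ t) j ↔ ξlim k = ξlim i := by
    intro t ht j hj k
    rw [mem_neighbors_of_notMem (hreg j hj), hT t ht, hj, eq_comm]
  have hmerge : ∀ t ≥ T, ∀ j, ξlim j = ξlim i → ξ (t + 1) j = ξ (t + 1) i := by
    intro t ht j hj
    have : neighbors O S (ξ t) j = neighbors O S (ξ t) i :=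
      Finset.ext fun k => by rw [hnb t ht j hj, hnb t ht i rfl]
    rw [hξ t, step, step, this]
  -- Merging takes the one step after `T`; from `T + 1` on all neighbors agree.
  have hstat : ∀ t ≥ T + 1, ξ t i = ξ (T + 1) i := by
    intro t ht
    induction t, ht using Nat.le_induction with
    | base => rfl
    | succ t ht ih =>
      rw [← ih, hξ t]
      refine step_eq_self hzero fun j hj => ?_
      obtain ⟨s, rfl⟩ : ∃ s, t = s + 1 := ⟨t - 1, by omega⟩
      exact hmerge s (by omega) j ((hnb _ (by omega) i rfl j).1 hj)
  have hev : ∀ᶠ t in atTop, ξ t i = ξ (T + 1) i := eventually_atTop.2 ⟨T + 1, hstat⟩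
  have hval : ξlim i = ξ (T + 1) i :=
    tendsto_nhds_unique (hlim i) (tendsto_const_nhds.congr' (hev.mono fun _ h => h.symm))
  simpa [hval] using hev

/-- If `O` is a neighborhood of `0`, then the limit state is clustered. -/
theorem IsSolution.isClustered_lim (hzero : 0 ∈ O) {ξ : ℕ → State V d} (hξ : IsSolution O S ξ)
    {ξlim : State V d} (hlim : ∀ i, Tendsto (fun t => ξ t i) atTop (𝓝 (ξlim i)))
    (heq : ∀ i j, (∃ᶠ t in atTop, Trusts O (ξ t) i j) → ξlim i = ξlim j) (hO : O ∈ 𝓝 0) :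
    IsClustered O ξlim := by
  -- `O` need not be open, so membership of limit differences does not pass to nearby opinions;
  -- agents holding the limits exactly avoid this.
  have hrep : ∀ i, ∃ j, ξlim j = ξlim i ∧ ∀ᶠ t in atTop, ξ t j = ξlim j := by
    intro i
    by_cases hi : ∃ j ∈ S, ξlim j = ξlim i
    · obtain ⟨j, hj, hji⟩ := hi
      have hconst : ∀ t, ξ t j = ξ 0 j := hξ.eq_of_mem hj
      refine ⟨j, hji, Eventually.of_forall fun t => ?_⟩
      rw [hconst t]
      exact tendsto_nhds_unique (tendsto_const_nhds.congr fun t => (hconst t).symm) (hlim j)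
    · push Not at hi
      exact ⟨i, rfl, hξ.eventually_eq_lim hzero hlim heq hO hi⟩
  intro i j
  by_cases hij : ξlim j - ξlim i ∈ O
  · left
    obtain ⟨i', hi', hti⟩ := hrep i
    obtain ⟨j', hj', htj⟩ := hrep j
    rw [← hi', ← hj']
    refine heq i' j' ((hti.and htj).frequently.mono fun t ht => ?_)
    rwa [Trusts, ht.1, ht.2, hi', hj']
  · exact Or.inr hij

end Dynamics

end SCOD

theorem theorem1 {V : Type*} [Fintype V] {d : ℕ}
    (O : Set (EuclideanSpace ℝ (Fin d))) (S : Set V)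
    (hzero : (0 : EuclideanSpace ℝ (Fin d)) ∈ O)
    (hsymm : ∀ x, x ∈ O ↔ -x ∈ O)
    (ξ : ℕ → SCOD.State V d) (hξ : SCOD.IsSolution O S ξ)
    (ξstar : EuclideanSpace ℝ (Fin d)) (hstub : ∀ i ∈ S, ξ 0 i = ξstar) :
    -- (A)
    (SCOD.IsEquilibrium O S (ξ 0) ↔ SCOD.IsClustered O (ξ 0)) ∧
    ∃ ξlim : SCOD.State V d,
      -- (B)
      (∀ i, Tendsto (fun t => ξ t i) atTop (𝓝 (ξlim i))) ∧
      (∀ i j, (∃ᶠ t in atTop, SCOD.Trusts O (ξ t) i j) → ξlim i = ξlim j) ∧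
      ((∃ R : ℝ, 0 < R ∧ Metric.ball 0 R ⊆ O) →
        -- (C)
        (SCOD.IsEquilibrium O S ξlim ∧ SCOD.IsClustered O ξlim) ∧
        -- (D)
        (S = ∅ → ∃ T, ∀ t, T ≤ t → ξ t = ξ T) ∧
        (S.Nonempty → ∀ i,
          Tendsto (fun t => ξ t i) atTop (𝓝 ξstar) ∨ ∃ T, ∀ t, T ≤ t → ξ t i = ξ T i)) := by
  obtain ⟨ξlim, hlim, heq⟩ := hξ.exists_tendsto hzero hsymm hstub
  refine ⟨⟨fun h => h.isClustered hzero hsymm hstub, fun h => h.isEquilibrium hzero⟩,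
    ξlim, hlim, heq, ?_⟩
  rintro ⟨R, hR, hRO⟩
  have hO : O ∈ 𝓝 0 := mem_of_superset (Metric.ball_mem_nhds 0 hR) hRO
  have hcl := hξ.isClustered_lim hzero hlim heq hO
  refine ⟨⟨hcl.isEquilibrium hzero, hcl⟩, ?_, fun _ i => ?_⟩
  · rintro rfl
    obtain ⟨T, hT⟩ := eventually_atTop.1 (eventually_all.2 fun i =>
      hξ.eventually_eq_lim hzero hlim heq hO (i := i) fun j hj => absurd hj (Set.notMem_empty j))
    exact ⟨T, fun t ht => funext fun i => (hT t ht i).trans (hT T le_rfl i).symm⟩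
  · by_cases hi : ∃ j ∈ S, ξlim j = ξlim i
    · left
      obtain ⟨j, hj, hji⟩ := hi
      have hconst : ∀ t, ξ t j = ξstar := fun t => (hξ.eq_of_mem hj t).trans (hstub j hj)
      have hval : ξstar = ξlim j :=
        tendsto_nhds_unique (tendsto_const_nhds.congr fun t => (hconst t).symm) (hlim j)
      rw [hval, hji]
      exact hlim i
    · right
      push Not at hi
      obtain ⟨T, hT⟩ := eventually_atTop.1 (hξ.eventually_eq_lim hzero hlim heq hO hi)
      exact ⟨T, fun t ht => (hT t ht).trans (hT T le_rfl).symm⟩
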